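/- Let $\mathbb O$ be the octonions, $\mathbb S=\{J\in\mathbb O: J^2=-1\}$, and $\mathbb C_J=\{x+yJ:x,y\in\mathbb R\}$ for $J\in\mathbb S$. A set $U\subseteq\mathbb O$ is slice-open if $U\cap\mathbb C_J$ is open in $\mathbb C_J$ for all $J\in\mathbb S$. Let $V$ be a Banach $\mathbb O$-bimodule, i.e. a real Banach space with unital real-bilinear left and right multiplications by $\mathbb O$ such that $[p,q,x]=[q,x,p]=[x,p,q]=-[q,p,x]$, $[x,p,q]=-[x,q,p]$ (with $[a,b,c]=(ab)c-a(bc)$) and $\|px\|=|p|\,\|x\|=\|xp\|$. Let $\operatorname{Re}x=\frac5{12}x-\frac1{12}\sum_{i=1}^7e_ixe_i$ be the projection of $V$ onto its real part $\operatorname{Re}V=\{m: pm=mp,\ [p,q,m]=0\ \forall p,q\in\mathbb O\}$, let $\pi_J x=\operatorname{Re}x+J\operatorname{Re}(\overline Jx)$, and let $R_s v=vs$. Let $T$ be a bounded right para-linear operator on $V$: $T$ is bounded, real linear, and $\operatorname{Re}(T(x)p-T(xp))=0$ for all $p\in\mathbb O$, $x\in V$. For $J\in\mathbb S$ let $\rho_{*J}(T)$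 be the set of those $s\in\mathbb C_J$ for which $R_s-T$ is invertible in the algebra of bounded real linear operators on $V$ and $A=(R_s-T)^{-1}$ is $\mathbb C_J$-liftable power associative, that is, $\operatorname{Re}(A^n(vt))=\operatorname{Re}(A^n(v)t)$ for all $n\ge1$, $v\in V$, $t\in\mathbb C_J$. Let $\rho_*(T)=\bigcup_{J\in\mathbb S}\rho_{*J}(T)$ be the push-forward resolvent set, and for $s\in\rho_{*J}(T)$ let $(R_s-T)^{-\circledcirc}(v)=\sum_{i=0}^7\operatorname{Re}\big((R_s-T)^{-1}(v\overline{e_i})\big)e_i$ be the left regular inverse of $R_s-T$. Then: 1. For every $J\in\mathbb S$, $\rho_{*J}(T)$ is open in $\mathbb C_J$. Consequently $\rho_*(T)\setminus\mathbb R$ is slice-open, and $\rho_*(T)$ itself is slice-open provided that every real point of $\rho_*(T)$ lies in $\rho_{*J}(T)$ for all $J\in\mathbb S$. 2. For all $v\in V$, $J\in\mathbb S$ and every continuous octonionic linear functional $\phi:V\to\mathbb O$ (real linear with $\phi(px)=p\,\phi(x)$), the function $g(s)=\phi\big(\pi_J(R_s-T)^{-\circledcirc}(v)\big)$ on $\rho_{*J}(T)$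 takes values in $\mathbb C_J$ and is holomorphic (with $\mathbb C_J$ identified with $\mathbb C$ by $x+yJ\leftrightarrow x+yi$). -/

import Mathlib

noncomputable section

/-- The octonions `x = ∑_{i=0}^7 x_i e_i`, with the Euclidean norm `|x| = √(∑ x_i²)`. -/
abbrev Octonion : Type := EuclideanSpace ℝ (Fin 8)

namespace Octonion

/-- The standard basis `e 0 = 1, e 1, …, e 7`. -/
def e (i : Fin 8) : Octonion := EuclideanSpace.single i 1

/-- The bilinear product with unit `e 0` and `e i * e j = ε i j k * e k - δ i j` for `i, j ≥ 1`,
with the oriented triples `(123), (145), (176), (246), (257), (347), (365)`. -/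
instance : Mul Octonion where
  mul x y := !₂[
      x 0 * y 0 - x 1 * y 1 - x 2 * y 2 - x 3 * y 3 - x 4 * y 4 - x 5 * y 5 - x 6 * y 6 - x 7 * y 7,
      x 0 * y 1 + x 1 * y 0 + x 2 * y 3 - x 3 * y 2 + x 4 * y 5 - x 5 * y 4 - x 6 * y 7 + x 7 * y 6,
      x 0 * y 2 - x 1 * y 3 + x 2 * y 0 + x 3 * y 1 + x 4 * y 6 + x 5 * y 7 - x 6 * y 4 - x 7 * y 5,
      x 0 * y 3 + x 1 * y 2 - x 2 * y 1 + x 3 * y 0 + x 4 * y 7 - x 5 * y 6 + x 6 * y 5 - x 7 * y 4,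
      x 0 * y 4 - x 1 * y 5 - x 2 * y 6 - x 3 * y 7 + x 4 * y 0 + x 5 * y 1 + x 6 * y 2 + x 7 * y 3,
      x 0 * y 5 + x 1 * y 4 - x 2 * y 7 + x 3 * y 6 - x 4 * y 1 + x 5 * y 0 - x 6 * y 3 + x 7 * y 2,
      x 0 * y 6 + x 1 * y 7 + x 2 * y 4 - x 3 * y 5 - x 4 * y 2 + x 5 * y 3 + x 6 * y 0 - x 7 * y 1,
      x 0 * y 7 - x 1 * y 6 + x 2 * y 5 + x 3 * y 4 - x 4 * y 3 - x 5 * y 2 + x 6 * y 1 + x 7 * y 0]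

instance : One Octonion where
  one := e 0

/-- Octonionic conjugation. -/
def conj (x : Octonion) : Octonion :=
  !₂[x 0, -x 1, -x 2, -x 3, -x 4, -x 5, -x 6, -x 7]

/-- The set `𝕊` of imaginary units. -/
def imagUnits : Set Octonion := {J | J * J = -1}

/-- The slice `ℂ_J = {x + y J : x, y ∈ ℝ}`. -/
def slice (J : Octonion) : Submodule ℝ Octonion := Submodule.span ℝ {1, J}

/-- The real octonions. -/
def reals : Set Octonion := {s | ∃ r : ℝ, s = r • (1 : Octonion)}

/-- The identification `ℂ → ℂ_J`, `x + y i ↦ x + y J`. -/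
def ofComplex (J : Octonion) (z : ℂ) : Octonion := z.re • (1 : Octonion) + z.im • J

/-- `U ∩ ℂ_J` is (relatively) open in `ℂ_J`. -/
def IsOpenInSlice (J : Octonion) (U : Set Octonion) : Prop :=
  IsOpen {s : slice J | (s : Octonion) ∈ U}

/-- Slice-open sets: `U ∩ ℂ_J` is open in `ℂ_J` for every imaginary unit `J`. -/
def IsSliceOpen (U : Set Octonion) : Prop := ∀ J ∈ imagUnits, IsOpenInSlice J U

/-- `g` maps `U ⊆ ℂ_J` into `ℂ_J`, and is holomorphic there when `ℂ_J` is identified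
with `ℂ`. -/
def IsHolomorphicOnSlice (J : Octonion) (g : Octonion → Octonion) (U : Set Octonion) : Prop :=
  (∀ s ∈ U, g s ∈ slice J) ∧
    ∃ h : ℂ → ℂ, DifferentiableOn ℂ h {z | ofComplex J z ∈ U} ∧
      ∀ z, ofComplex J z ∈ U → g (ofComplex J z) = ofComplex J (h z)

end Octonion

open Octonion

/-- A (unital) `𝕆`-bimodule: real-bilinear left and right multiplications, `lmul p x = p x` and
`rmul x p = x p`, such that the right associator is alternating and
`[p, q, x] = [q, x, p] = [x, p, q] = -[q, p, x]`. -/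
class OctonionBimodule (V : Type*) [AddCommGroup V] [Module ℝ V] where
  lmul : Octonion →ₗ[ℝ] V →ₗ[ℝ] V
  rmul : V →ₗ[ℝ] Octonion →ₗ[ℝ] V
  one_lmul : ∀ x, lmul 1 x = x
  rmul_one : ∀ x, rmul x 1 = x
  assoc_right : ∀ (x : V) (p q : Octonion),
    rmul (rmul x p) q - rmul x (p * q) = -(rmul (rmul x q) p - rmul x (q * p))
  assoc_left_mid : ∀ (p q : Octonion) (x : V),
    lmul (p * q) x - lmul p (lmul q x) = rmul (lmul q x) p - lmul q (rmul x p)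
  assoc_mid_right : ∀ (p q : Octonion) (x : V),
    rmul (lmul q x) p - lmul q (rmul x p) = rmul (rmul x p) q - rmul x (p * q)
  assoc_left : ∀ (p q : Octonion) (x : V),
    lmul (p * q) x - lmul p (lmul q x) = -(lmul (q * p) x - lmul q (lmul p x))

/-- A normed `𝕆`-bimodule: `‖p x‖ = |p| ‖x‖ = ‖x p‖`. It is a Banach `𝕆`-bimodule when `V` is
complete. -/
class NormedOctonionBimodule (V : Type*) [NormedAddCommGroup V] [NormedSpace ℝ V] extends
    OctonionBimodule V where
  norm_lmul : ∀ (p : Octonion) (x : V), ‖lmul p x‖ = ‖p‖ * ‖x‖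
  norm_rmul : ∀ (x : V) (p : Octonion), ‖rmul x p‖ = ‖p‖ * ‖x‖

namespace OctonionBimodule

section Algebra

variable {V : Type*} [AddCommGroup V] [Module ℝ V] [OctonionBimodule V]

/-- The real part operator of a bimodule, i.e. the projection of `V = ⨁ᵢ eᵢ Re V` onto
`Re V = {m | [p, q, m] = 0 and p m = m p for all p, q}`:
`Re x = (5/12) x - (1/12) ∑_{i=1}^7 (e_i x) e_i`. -/
def rePart : V →ₗ[ℝ] V :=
  (5 / 12 : ℝ) • LinearMap.id -
    (1 / 12 : ℝ) • ∑ i : Fin 7, (rmul (V := V)).flip (e i.succ) ∘ₗ lmul (e i.succ)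

/-- The projection `π_J x = Re x + J Re (J̄ x)` onto `ℂ_J(V) = Re V ⊕ J Re V`. -/
def sliceProj (J : Octonion) (x : V) : V :=
  rePart x + lmul J (rePart (lmul (conj J) x))

/-- The right lifting map `(lif f)(x) = ∑_{i=0}^7 f(x ē_i) e_i`, for real linear `f` (with
values in `Re V`). -/
def liftR (f : V →ₗ[ℝ] V) (x : V) : V := ∑ i : Fin 8, rmul (f (rmul x (conj (e i)))) (e i)

end Algebra

variable {V : Type*} [NormedAddCommGroup V] [NormedSpace ℝ V] [NormedOctonionBimodule V]

/-- The bounded real linear operator `R_s : v ↦ v s`. -/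
def rightMul (s : Octonion) : V →L[ℝ] V :=
  LinearMap.mkContinuous ((rmul (V := V)).flip s) ‖s‖
    (fun x => (NormedOctonionBimodule.norm_rmul x s).le)

/-- `T` is right para-linear: `Re (T(x) p - T(x p)) = 0` for all `p ∈ 𝕆`, `x ∈ V`. -/
def IsRightParaLinear (T : V →L[ℝ] V) : Prop :=
  ∀ (p : Octonion) (x : V), rePart (rmul (T x) p - T (rmul x p)) = 0

/-- A continuous real linear functional `φ : V → 𝕆` is octonionic linear if
`φ(p x) = p φ(x)` (on bimodules this is equivalent to `φ(x p) = φ(x) p`). -/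
def IsOctonionLinear (φ : V →L[ℝ] Octonion) : Prop :=
  ∀ (p : Octonion) (x : V), φ (lmul p x) = p * φ x

/-- `T` is `ℂ_J`-liftable power associative: `Re (T^n(v s)) = Re (T^n(v) s)` for `n = 1, 2, …`,
`v ∈ V`, `s ∈ ℂ_J`. -/
def IsLiftablePowerAssociative (J : Octonion) (T : V →L[ℝ] V) : Prop :=
  ∀ n : ℕ, 1 ≤ n → ∀ (v : V), ∀ s ∈ slice J,
    rePart ((T ^ n) (rmul v s)) = rePart (rmul ((T ^ n) v) s)

/-- The left regular inverse `T^{-⊚} = lif (Re ∘ T⁻¹)` of an operator `T` that is invertible in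
the algebra of bounded real linear operators. -/
def leftRegularInverse (T : V →L[ℝ] V) : V → V :=
  liftR (rePart ∘ₗ (Ring.inverse T : V →L[ℝ] V).toLinearMap)

/-- The push-forward slice-resolvent set `ρ_{*J}(T) ⊆ ℂ_J`. -/
def pushSliceResolventSet (J : Octonion) (T : V →L[ℝ] V) : Set Octonion :=
  {s | s ∈ slice J ∧ IsUnit (rightMul s - T) ∧
    IsLiftablePowerAssociative J (Ring.inverse (rightMul s - T))}

/-- The push-forward resolvent set `ρ_*(T) = ⋃_J ρ_{*J}(T)`. -/
def pushResolventSet (T : V →L[ℝ] V) : Set Octonion :=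
  ⋃ J ∈ imagUnits, pushSliceResolventSet J T

end OctonionBimodule

end

open Octonion

/-! ### Octonion arithmetic and slices. -/

namespace Octonion

/-! Openness is a Neumann series argument. With `A = (R_{s₀} - T)⁻¹` and `s` near `s₀` in the slice,
`R_s - T = (R_{s₀} - T)(1 - B)`, where `B = A R_{s₀ - s}`, so the new inverse is `(∑ Bⁿ) A`. Its
powers must again be liftable. They all lie in `liftableSubmodule J A`, a closed subspace that
contains `1` and is stable under left multiplication by `A` and by `R_J`, hence by `B` and by the
sum of the series.

For holomorphy, a left linear functional `φ` also commutes with right multiplication by imaginary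
units (`map_rmul_imagUnit`), so it carries the real part of `V` to the real part of `𝕆`. Therefore
`φ(π_J(lif(Re ∘ f))(v))` has coordinates `φ(f v)₀` and `-φ(f(vJ))₀` in `ℂ_J`
(`map_sliceProj_liftR`). The resolvent has derivative `h ↦ -A R_h A`, and liftability of `A` and
`A²` lets `R_J` move to the right under `Re`, which gives the Cauchy–Riemann equation. -/

theorem mul_def (x y : Octonion) : x * y = !₂[
      x 0 * y 0 - x 1 * y 1 - x 2 * y 2 - x 3 * y 3 - x 4 * y 4 - x 5 * y 5 - x 6 * y 6 - x 7 * y 7,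
      x 0 * y 1 + x 1 * y 0 + x 2 * y 3 - x 3 * y 2 + x 4 * y 5 - x 5 * y 4 - x 6 * y 7 + x 7 * y 6,
      x 0 * y 2 - x 1 * y 3 + x 2 * y 0 + x 3 * y 1 + x 4 * y 6 + x 5 * y 7 - x 6 * y 4 - x 7 * y 5,
      x 0 * y 3 + x 1 * y 2 - x 2 * y 1 + x 3 * y 0 + x 4 * y 7 - x 5 * y 6 + x 6 * y 5 - x 7 * y 4,
      x 0 * y 4 - x 1 * y 5 - x 2 * y 6 - x 3 * y 7 + x 4 * y 0 + x 5 * y 1 + x 6 * y 2 + x 7 * y 3,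
      x 0 * y 5 + x 1 * y 4 - x 2 * y 7 + x 3 * y 6 - x 4 * y 1 + x 5 * y 0 - x 6 * y 3 + x 7 * y 2,
      x 0 * y 6 + x 1 * y 7 + x 2 * y 4 - x 3 * y 5 - x 4 * y 2 + x 5 * y 3 + x 6 * y 0 - x 7 * y 1,
      x 0 * y 7 - x 1 * y 6 + x 2 * y 5 + x 3 * y 4 - x 4 * y 3 - x 5 * y 2 + x 6 * y 1 + x 7 * y 0] :=
  rfl

theorem one_def : (1 : Octonion) = e 0 := rfl

protected theorem mul_smul (c : ℝ) (x y : Octonion) : x * (c • y) = c • (x * y) := by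
  ext i; fin_cases i <;> simp [mul_def] <;> ring

protected theorem smul_mul (c : ℝ) (x y : Octonion) : (c • x) * y = c • (x * y) := by
  ext i; fin_cases i <;> simp [mul_def] <;> ring

protected theorem mul_sub (x y z : Octonion) : x * (y - z) = x * y - x * z := by
  ext i; fin_cases i <;> simp [mul_def] <;> ring

protected theorem sub_mul (x y z : Octonion) : (x - y) * z = x * z - y * z := by
  ext i; fin_cases i <;> simp [mul_def] <;> ring

protected theorem mul_neg (x y : Octonion) : x * -y = -(x * y) := by
  ext i; fin_cases i <;> simp [mul_def] <;> ring

protected theorem mul_one (x : Octonion) : x * 1 = x := by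
  ext i; fin_cases i <;> simp [mul_def, one_def, e]

theorem mul_mul_self (x p : Octonion) : (x * p) * p = x * (p * p) := by
  ext i; fin_cases i <;> simp [mul_def] <;> ring

/-- The associator is invariant under cyclic permutations. -/
theorem associator_cyclic (p q y : Octonion) :
    (p * q) * y - p * (q * y) = (q * y) * p - q * (y * p) := by
  ext i; fin_cases i <;> simp [mul_def] <;> ring

theorem mul_conj_mul_self (r y : Octonion) : (r * conj y) * y = (∑ i, y i ^ 2) • r := by
  ext i; fin_cases i <;> simp [mul_def, conj, Fin.sum_univ_eight] <;> ring

theorem apply_zero_of_mem_imagUnits {J : Octonion} (hJ : J ∈ imagUnits) : J 0 = 0 := by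
  have h : ∀ i, (J * J) i = (-1 : Octonion) i := fun i => by rw [show J * J = -1 from hJ]
  have h0 := h 0
  have h1 := h 1
  have h2 := h 2
  have h3 := h 3
  have h4 := h 4
  have h5 := h 5
  have h6 := h 6
  have h7 := h 7
  simp [mul_def, one_def, e] at h0 h1 h2 h3 h4 h5 h6 h7
  by_contra h
  have key : ∀ x, J 0 * x + x * J 0 = 0 → x = 0 := fun x hx => by
    have : J 0 * x = 0 := by linarith
    exact (mul_eq_zero.mp this).resolve_left h
  have k1 := key (J 1) (by linarith)
  have k2 := key (J 2) (by linarith)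
  have k3 := key (J 3) (by linarith)
  have k4 := key (J 4) (by linarith)
  have k5 := key (J 5) (by linarith)
  have k6 := key (J 6) (by linarith)
  have k7 := key (J 7) (by linarith)
  rw [k1, k2, k3, k4, k5, k6, k7] at h0
  nlinarith [sq_nonneg (J 0)]

theorem ne_zero_of_mem_imagUnits {J : Octonion} (hJ : J ∈ imagUnits) : J ≠ 0 := by
  rintro rfl
  have h : ((0 : Octonion) * 0) 0 = (-1 : Octonion) 0 := by rw [show (0 : Octonion) * 0 = -1 from hJ]
  simp [mul_def, one_def, e] at h

theorem e_succ_mem_imagUnits (i : Fin 7) : e i.succ ∈ imagUnits := by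
  change e i.succ * e i.succ = -1
  ext j; fin_cases i <;> fin_cases j <;> simp [mul_def, one_def, e]

theorem e_succ_mul_mul_e_succ_apply (i : Fin 7) (y : Octonion) (j : Fin 8) :
    ((e i.succ * y) * e i.succ) j = if j = 0 ∨ j = i.succ then -y j else y j := by
  fin_cases i <;> fin_cases j <;> simp [mul_def, e, Fin.ext_iff]

/-- An octonion that associates with all others in last position is real. -/
theorem apply_eq_zero_of_associator {p : Octonion}
    (h : ∀ q r : Octonion, (q * r) * p = q * (r * p)) (i : Fin 7) : p i.succ = 0 := by
  -- Three associators of basis units already detect every imaginary coordinate of `p`.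
  have h12 : ∀ j, ((e 1 * e 2) * p) j = (e 1 * (e 2 * p)) j := fun j => by rw [h]
  have h14 : ∀ j, ((e 1 * e 4) * p) j = (e 1 * (e 4 * p)) j := fun j => by rw [h]
  have h24 : ∀ j, ((e 2 * e 4) * p) j = (e 2 * (e 4 * p)) j := fun j => by rw [h]
  have a4 := h12 4
  have a5 := h12 5
  have a6 := h12 6
  have a7 := h12 7
  have b7 := h14 7
  have c7 := h24 7
  have c5 := h24 5
  simp [mul_def, e] at a4 a5 a6 a7 b7 c7 c5
  fin_cases i <;> simp <;> linarith

theorem mem_slice_iff {J s : Octonion} : s ∈ slice J ↔ ∃ z, ofComplex J z = s := by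
  rw [slice, Submodule.mem_span_pair]
  exact ⟨fun ⟨a, b, h⟩ => ⟨⟨a, b⟩, h⟩, fun ⟨z, h⟩ => ⟨z.re, z.im, h⟩⟩

theorem one_mem_slice (J : Octonion) : 1 ∈ slice J := Submodule.subset_span (by simp)

theorem self_mem_slice (J : Octonion) : J ∈ slice J := Submodule.subset_span (by simp)

/-- Two slices that share a non-real point coincide. -/
theorem slice_eq_of_mem {J K s : Octonion} (hJ : J ∈ imagUnits) (hK : K ∈ imagUnits)
    (hsJ : s ∈ slice J) (hsK : s ∈ slice K) (hs : s ∉ reals) : slice K = slice J := by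
  suffices H : ∀ {J K : Octonion}, J ∈ imagUnits → K ∈ imagUnits → s ∈ slice J → s ∈ slice K →
      slice K ≤ slice J from le_antisymm (H hJ hK hsJ hsK) (H hK hJ hsK hsJ)
  clear hJ hK hsJ hsK J K
  intro J K hJ hK hsJ hsK
  obtain ⟨z, rfl⟩ := mem_slice_iff.mp hsK
  have him : z.im ≠ 0 := fun h => hs ⟨z.re, by simp [ofComplex, h]⟩
  have h1 : z.im • K ∈ slice J := by
    have := Submodule.sub_mem _ hsJ (Submodule.smul_mem _ z.re (one_mem_slice J))
    simpa [ofComplex] using this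
  have h2 : K ∈ slice J := by simpa [him] using Submodule.smul_mem _ z.im⁻¹ h1
  exact Submodule.span_le.mpr (Set.insert_subset (one_mem_slice J) (Set.singleton_subset_iff.mpr h2))

theorem isClosed_reals : IsClosed reals := by
  have : reals = (Submodule.span ℝ {(1 : Octonion)} : Set Octonion) := by
    ext s; simp [reals, Submodule.mem_span_singleton, eq_comm]
  rw [this]
  exact Submodule.closed_of_finiteDimensional _

end Octonion

/-! ### Left linear functionals on a bimodule. -/

namespace OctonionBimodule

section Algebra

variable {V : Type*} [AddCommGroup V] [Module ℝ V] [OctonionBimodule V]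

theorem rmul_rmul_self (x : V) (p : Octonion) : rmul (rmul x p) p = rmul x (p * p) := by
  have h := assoc_right x p p
  rw [eq_neg_iff_add_eq_zero, ← two_smul ℝ, smul_eq_zero] at h
  exact sub_eq_zero.mp (h.resolve_left two_ne_zero)

theorem rmul_rmul_imagUnit {J : Octonion} (hJ : J ∈ imagUnits) (x : V) :
    rmul (rmul x J) J = -x := by
  rw [rmul_rmul_self, show J * J = -1 from hJ, map_neg, rmul_one]

variable {φ : V →ₗ[ℝ] Octonion}

/-- The defect of right linearity of a left linear functional is left linear. -/
theorem map_rmul_sub_lmul (hφ : ∀ (p : Octonion) (x : V), φ (lmul p x) = p * φ x)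
    (p q : Octonion) (x : V) :
    φ (rmul (lmul q x) p) - φ (lmul q x) * p = q * (φ (rmul x p) - φ x * p) := by
  have h := congrArg φ (assoc_left_mid p q x)
  simp only [map_sub, hφ] at h
  rw [associator_cyclic] at h
  rw [hφ, Octonion.mul_sub]
  rw [sub_eq_sub_iff_add_eq_add] at h ⊢
  rw [← h, add_comm]

/-- A left linear functional commutes with right multiplication by an imaginary unit. -/
theorem map_rmul_imagUnit (hφ : ∀ (p : Octonion) (x : V), φ (lmul p x) = p * φ x)
    {J : Octonion} (hJ : J ∈ imagUnits) (x : V) : φ (rmul x J) = φ x * J := by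
  let χ : V → Octonion := fun x => φ (rmul x J) - φ x * J
  have hχ : ∀ q x, χ (lmul q x) = q * χ x := fun q x => map_rmul_sub_lmul hφ J q x
  have hχsub : ∀ x y, χ (x - y) = χ x - χ y := fun x y => by
    simp only [χ, map_sub, LinearMap.sub_apply, Octonion.sub_mul]; abel
  have hχJ : ∀ x, χ (rmul x J) = -(χ x * J) := fun x => by
    simp only [χ, Octonion.sub_mul, mul_mul_self, rmul_rmul_imagUnit hJ,
      show J * J = -1 from hJ, Octonion.mul_neg, Octonion.mul_one, map_neg]
    abel
  -- Applying `χ` to the bimodule associator identity equates the associator `[q, χ x, J]` with its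
  -- own negative, because `χ (x J) = -(χ x) J`.
  have hassoc : ∀ q x, (q * χ x) * J = q * (χ x * J) := fun q x => by
    have h := congrArg χ (assoc_left_mid J q x)
    simp only [hχsub, hχ, hχJ, associator_cyclic J q, Octonion.mul_neg] at h
    have h2 : (2 : ℝ) • ((q * χ x) * J - q * (χ x * J)) = 0 := by
      rw [two_smul]; nth_rewrite 1 [h]; abel
    exact sub_eq_zero.mp ((smul_eq_zero.mp h2).resolve_left two_ne_zero)
  suffices χ x = 0 from sub_eq_zero.mp this
  by_contra hne
  have hpos : (∑ i, χ x i ^ 2) ≠ 0 := fun h => hne <| by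
    ext i
    have := (Finset.sum_eq_zero_iff_of_nonneg (fun i _ => sq_nonneg (χ x i))).mp h i
      (Finset.mem_univ i)
    simpa using this
  apply ne_zero_of_mem_imagUnits hJ
  -- Replacing `x` by `(r * conj (χ x)) x` turns `χ x` into a nonzero real multiple of an arbitrary
  -- `r`, so `J` would associate with everything and be real.
  have hJ' : ∀ q r : Octonion, (q * r) * J = q * (r * J) := fun q r => by
    have h := hassoc q (lmul (r * conj (χ x)) x)
    rw [hχ, mul_conj_mul_self, Octonion.mul_smul, Octonion.smul_mul, Octonion.smul_mul,
      Octonion.mul_smul] at h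
    exact smul_right_injective _ hpos h
  ext i
  refine Fin.cases ?_ (fun i => ?_) i
  · simpa using apply_zero_of_mem_imagUnits hJ
  · simpa using apply_eq_zero_of_associator hJ' i

theorem map_rmul_e (hφ : ∀ (p : Octonion) (x : V), φ (lmul p x) = p * φ x)
    (i : Fin 8) (x : V) : φ (rmul x (e i)) = φ x * e i := by
  refine Fin.cases ?_ (fun i => map_rmul_imagUnit hφ (e_succ_mem_imagUnits i) x) i
  rw [← one_def, rmul_one, Octonion.mul_one]

/-- A left linear functional maps the real part to the real part. -/
theorem map_rePart (hφ : ∀ (p : Octonion) (x : V), φ (lmul p x) = p * φ x) (x : V) :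
    φ (rePart x) = (φ x) 0 • (1 : Octonion) := by
  simp only [rePart, LinearMap.sub_apply, LinearMap.smul_apply, LinearMap.id_apply,
    LinearMap.sum_apply, LinearMap.comp_apply, LinearMap.flip_apply, map_sub, map_smul, map_sum,
    map_rmul_e hφ, hφ]
  generalize φ x = y
  ext j
  simp only [PiLp.sub_apply, PiLp.smul_apply, WithLp.ofLp_sum, Finset.sum_apply,
    e_succ_mul_mul_e_succ_apply, smul_eq_mul]
  refine Fin.cases ?_ (fun k => ?_) j
  -- On coordinate `0` all seven products `e_i y e_i` give `-y 0`, and `5/12 + 7/12 = 1`. On any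
  -- other coordinate six signs are positive and one is negative, and `5/12 - 5/12 = 0`.
  · simp [one_def, e]; ring
  · have h : ∀ i, (if k = i then -y k.succ else y k.succ) =
        y k.succ - if k = i then 2 * y k.succ else 0 := fun i => by split_ifs <;> ring
    simp [one_def, e, h]; ring

theorem map_liftR_rePart_apply (hφ : ∀ (p : Octonion) (x : V), φ (lmul p x) = p * φ x)
    (f : V →ₗ[ℝ] V) (v : V) (i : Fin 8) :
    φ (liftR (rePart ∘ₗ f) v) i = φ (f (rmul v (conj (e i)))) 0 := by
  simp only [liftR, map_sum, map_rmul_e hφ, LinearMap.comp_apply, map_rePart hφ,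
    Octonion.smul_mul]
  fin_cases i <;> simp [Fin.sum_univ_eight, mul_def, e, one_def]

/-- The component of `π_J (lif (Re ∘ f))` along a left linear functional. -/
theorem map_sliceProj_liftR (hφ : ∀ (p : Octonion) (x : V), φ (lmul p x) = p * φ x)
    {J : Octonion} (hJ : J ∈ imagUnits) (f : V →ₗ[ℝ] V) (v : V) :
    φ (sliceProj J (liftR (rePart ∘ₗ f) v)) =
      ofComplex J ⟨φ (f v) 0, -(φ (f (rmul v J)) 0)⟩ := by
  -- Since `J 0 = 0`, conjugation only changes the sign of `J`.
  have hdecomp : J = -∑ i, J i • conj (e i) := by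
    have := apply_zero_of_mem_imagUnits hJ
    ext j; fin_cases j <;> simp [Fin.sum_univ_eight, conj, e, this]
  have hlin : φ (f (rmul v J)) 0 = -∑ i, J i * φ (f (rmul v (conj (e i)))) 0 := by
    conv_lhs => rw [hdecomp]
    simp [map_sum]
  have h0 : φ (liftR (rePart ∘ₗ f) v) 0 = φ (f v) 0 := by
    rw [map_liftR_rePart_apply hφ, show conj (e 0) = 1 from ?_, rmul_one]
    ext j; fin_cases j <;> simp [conj, e, one_def]
  have hinner : ∀ y : Octonion, (conj J * y) 0 = ∑ i, J i * y i := fun y => by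
    simp [mul_def, conj, Fin.sum_univ_eight]
  rw [sliceProj, map_add, hφ, map_rePart hφ, map_rePart hφ, hφ, h0, hinner, hlin,
    Octonion.mul_smul, Octonion.mul_one, neg_neg]
  simp only [map_liftR_rePart_apply hφ]
  rfl

end Algebra

end OctonionBimodule

/-! ### Stability of liftable operators and the Neumann series. -/

namespace OctonionBimodule

variable {V : Type*} [NormedAddCommGroup V] [NormedSpace ℝ V] [NormedOctonionBimodule V]

@[simp]
theorem rightMul_apply (s : Octonion) (v : V) : rightMul s v = rmul v s := rfl

theorem rightMul_sub (s t : Octonion) : rightMul (V := V) (s - t) = rightMul s - rightMul t := by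
  ext v; simp

theorem rightMul_ofComplex (J : Octonion) (z : ℂ) :
    rightMul (V := V) (ofComplex J z) = z.re • 1 + z.im • rightMul J := by
  ext v; simp [ofComplex, rmul_one]

theorem norm_rightMul_le (s : Octonion) : ‖rightMul (V := V) s‖ ≤ ‖s‖ :=
  LinearMap.mkContinuous_norm_le _ (norm_nonneg s) _

theorem rightMul_imagUnit_sq {J : Octonion} (hJ : J ∈ imagUnits) (x : V) :
    rightMul J (rightMul J x) = -x := rmul_rmul_imagUnit hJ x

theorem continuous_rePart : Continuous (rePart : V → V) := by
  have h : ∀ i : Fin 7, Continuous fun x : V => rmul (lmul (e i.succ) x) (e i.succ) := fun i => by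
    have h1 : Continuous fun x : V => lmul (e i.succ) x :=
      (LinearMap.mkContinuous (lmul (V := V) (e i.succ)) ‖e i.succ‖
        (fun x => (NormedOctonionBimodule.norm_lmul _ x).le)).continuous
    exact (rightMul (V := V) (e i.succ)).continuous.comp h1
  have : (rePart : V → V) = fun x => (5 / 12 : ℝ) • x -
      (1 / 12 : ℝ) • ∑ i : Fin 7, rmul (lmul (e i.succ) x) (e i.succ) := by
    ext x; simp [rePart]
  rw [this]
  fun_prop

/-- Liftable power associativity only has to be tested on the imaginary unit. -/
theorem isLiftablePowerAssociative_iff {J : Octonion} {A : V →L[ℝ] V} :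
    IsLiftablePowerAssociative J A ↔
      ∀ (n : ℕ) (v : V), rePart ((A ^ n) (rightMul J v)) = rePart (rightMul J ((A ^ n) v)) := by
  constructor
  · intro h n v
    rcases n.eq_zero_or_pos with rfl | hn
    · simp
    · exact h n hn v J (self_mem_slice J)
  · intro h n _ v s hs
    obtain ⟨z, rfl⟩ := mem_slice_iff.mp hs
    have := h n v
    simp only [rightMul_apply] at this
    simp only [ofComplex, map_add, map_smul, rmul_one, this]

/-- The operators `W` for which all `A ^ n * W` are complex linear modulo the kernel of `Re`. -/
def liftableSubmodule (J : Octonion) (A : V →L[ℝ] V) : Submodule ℝ (V →L[ℝ] V) where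
  carrier := {W | ∀ (n : ℕ) (v : V),
    rePart ((A ^ n) (W (rightMul J v))) = rePart (rightMul J ((A ^ n) (W v)))}
  add_mem' {W X} hW hX n v := by
    have h1 := hW n v
    have h2 := hX n v
    simp only [add_apply, map_add] at h1 h2 ⊢
    rw [h1, h2]
  zero_mem' n v := by simp
  smul_mem' c W hW n v := by
    have h1 := hW n v
    simp only [smul_apply, map_smul] at h1 ⊢
    rw [h1]

theorem mem_liftableSubmodule {J : Octonion} {A W : V →L[ℝ] V} :
    W ∈ liftableSubmodule J A ↔ ∀ (n : ℕ) (v : V),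
      rePart ((A ^ n) (W (rightMul J v))) = rePart (rightMul J ((A ^ n) (W v))) := Iff.rfl

theorem isClosed_liftableSubmodule (J : Octonion) (A : V →L[ℝ] V) :
    IsClosed (liftableSubmodule J A : Set (V →L[ℝ] V)) := by
  have : (liftableSubmodule J A : Set (V →L[ℝ] V)) = ⋂ (n : ℕ) (v : V),
      {W | rePart ((A ^ n) (W (rightMul J v))) = rePart (rightMul J ((A ^ n) (W v)))} := by
    ext W; simp [mem_liftableSubmodule]
  rw [this]
  refine isClosed_iInter fun n => isClosed_iInter fun v => isClosed_eq ?_ ?_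
  · exact continuous_rePart.comp ((A ^ n).continuous.comp (by fun_prop))
  · exact continuous_rePart.comp ((rightMul J).continuous.comp ((A ^ n).continuous.comp (by fun_prop)))

section

variable {J : Octonion} {A W : V →L[ℝ] V}

theorem one_mem_liftableSubmodule (hA : IsLiftablePowerAssociative J A) :
    1 ∈ liftableSubmodule J A := fun n v => isLiftablePowerAssociative_iff.mp hA n v

/-- The extra factor `A` is absorbed by passing from `n` to `n + 1`, which is why membership is
tested against all powers of `A`. -/
theorem mul_mem_liftableSubmodule (hW : W ∈ liftableSubmodule J A) :
    A * W ∈ liftableSubmodule J A := fun n v => by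
  have := hW (n + 1) v
  simpa [pow_succ] using this

/-- If `Re ∘ X` commutes with `J`, then `Re ∘ J ∘ X` does. -/
theorem rePart_rightMul_comm (hJ : J ∈ imagUnits) {X : V →L[ℝ] V}
    (hX : ∀ v, rePart (X (rightMul J v)) = rePart (rightMul J (X v))) (v : V) :
    rePart (rightMul J (X (rightMul J v))) = rePart (rightMul J (rightMul J (X v))) := by
  rw [← hX, rightMul_imagUnit_sq hJ, rightMul_imagUnit_sq hJ, map_neg]

/-- Modulo the kernel of `Re`, liftability of `A ^ n` moves the inner `J` outside;
`rePart_rightMul_comm` then handles the two nested factors, for `A ^ n * W` and again for `A ^ n`.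
-/
theorem rightMul_mul_mem_liftableSubmodule (hJ : J ∈ imagUnits)
    (hA : IsLiftablePowerAssociative J A) (hW : W ∈ liftableSubmodule J A) :
    rightMul J * W ∈ liftableSubmodule J A := fun n v => by
  have h1 := isLiftablePowerAssociative_iff.mp hA n
  have h2 : rePart (rightMul J ((A ^ n) (W (rightMul J v)))) =
      rePart (rightMul J (rightMul J ((A ^ n) (W v)))) :=
    rePart_rightMul_comm (X := A ^ n * W) hJ (hW n) v
  have h3 := rePart_rightMul_comm hJ h1 (W v)
  simp only [mul_apply_eq_comp]
  rw [h1, h2, h3]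

theorem rightMul_slice_mul_mem_liftableSubmodule (hJ : J ∈ imagUnits)
    (hA : IsLiftablePowerAssociative J A) (hW : W ∈ liftableSubmodule J A) {s : Octonion}
    (hs : s ∈ slice J) : rightMul s * W ∈ liftableSubmodule J A := by
  obtain ⟨z, rfl⟩ := mem_slice_iff.mp hs
  rw [rightMul_ofComplex, add_mul, smul_mul_assoc, smul_mul_assoc, one_mul]
  exact add_mem (Submodule.smul_mem _ _ hW)
    (Submodule.smul_mem _ _ (rightMul_mul_mem_liftableSubmodule hJ hA hW))

variable [CompleteSpace V]

theorem inverse_one_sub_mul_mem_liftableSubmodule {B : V →L[ℝ] V} (hB : ‖B‖ < 1)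
    (hBmem : ∀ W ∈ liftableSubmodule J A, B * W ∈ liftableSubmodule J A)
    (hW : W ∈ liftableSubmodule J A) : Ring.inverse (1 - B) * W ∈ liftableSubmodule J A := by
  have hs := (summable_geometric_of_norm_lt_one hB).hasSum.mul_right W
  have hpow : ∀ n : ℕ, B ^ n * W ∈ liftableSubmodule J A := fun n => by
    induction n with
    | zero => simpa using hW
    | succ n ih => rw [pow_succ', mul_assoc]; exact hBmem _ ih
  have hmem : (∑' n : ℕ, B ^ n) * W ∈ liftableSubmodule J A :=
    (isClosed_liftableSubmodule J A).mem_of_tendsto hs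
      (Filter.Eventually.of_forall fun F => Submodule.sum_mem _ fun n _ => hpow n)
  have hinv : Ring.inverse (1 - B) = ∑' n : ℕ, B ^ n := by
    have := NormedRing.inverse_one_sub B hB
    rw [this]
    rfl
  rwa [hinv]

/-- A point of the resolvent set has a neighbourhood in the slice of explicit radius. -/
theorem mem_pushSliceResolventSet_of_norm_lt {T : V →L[ℝ] V} (hJ : J ∈ imagUnits)
    {s₀ s : Octonion} (hs₀ : s₀ ∈ pushSliceResolventSet J T) (hs : s ∈ slice J)
    (hlt : ‖Ring.inverse (rightMul s₀ - T)‖ * ‖s₀ - s‖ < 1) :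
    s ∈ pushSliceResolventSet J T := by
  obtain ⟨hs₀J, hu, hA⟩ := hs₀
  set A : V →L[ℝ] V := Ring.inverse (rightMul s₀ - T) with hAdef
  let B : V →L[ℝ] V := A * rightMul (s₀ - s)
  have hB : ‖B‖ < 1 := ((norm_mul_le _ _).trans
    (mul_le_mul_of_nonneg_left (norm_rightMul_le _) (norm_nonneg _))).trans_lt hlt
  have hfac : rightMul s - T = (rightMul s₀ - T) * (1 - B) := by
    rw [mul_sub, mul_one, ← mul_assoc, Ring.mul_inverse_cancel _ hu, one_mul, rightMul_sub]
    abel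
  have hu1 : IsUnit (1 - B) := isUnit_one_sub_of_norm_lt_one hB
  refine ⟨hs, hfac ▸ hu.mul hu1, ?_⟩
  have hinv : Ring.inverse (rightMul s - T) = Ring.inverse (1 - B) * A := by
    obtain ⟨a, ha⟩ := hu
    obtain ⟨b, hb⟩ := hu1
    rw [hfac, hAdef, ← ha, ← hb, ← Units.val_mul, Ring.inverse_unit, Ring.inverse_unit,
      Ring.inverse_unit, mul_inv_rev, Units.val_mul]
  have hBmem : ∀ W ∈ liftableSubmodule J A, B * W ∈ liftableSubmodule J A := fun W hW => by
    rw [show B * W = A * (rightMul (s₀ - s) * W) from mul_assoc _ _ _]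
    exact mul_mem_liftableSubmodule
      (rightMul_slice_mul_mem_liftableSubmodule hJ hA hW (Submodule.sub_mem _ hs₀J hs))
  have hpow : ∀ n : ℕ, Ring.inverse (rightMul s - T) ^ n ∈ liftableSubmodule J A := fun n => by
    induction n with
    | zero => simpa using one_mem_liftableSubmodule hA
    | succ n ih =>
      rw [pow_succ', hinv, mul_assoc, ← hinv]
      exact inverse_one_sub_mul_mem_liftableSubmodule hB hBmem (mul_mem_liftableSubmodule ih)
  -- Membership of the powers of the new inverse is used only with exponent `0` of `A`.
  exact isLiftablePowerAssociative_iff.mpr fun n v => by simpa using hpow n 0 v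

end

/-! ### Openness of the resolvent sets. -/

variable {T : V →L[ℝ] V}

theorem isOpenInSlice_pushSliceResolventSet [CompleteSpace V] (T : V →L[ℝ] V) {J : Octonion}
    (hJ : J ∈ imagUnits) : IsOpenInSlice J (pushSliceResolventSet J T) := by
  refine isOpen_iff_mem_nhds.mpr fun s₀ hs₀ => ?_
  have hc : Continuous fun s : slice J =>
      ‖Ring.inverse (rightMul (s₀ : Octonion) - T)‖ * ‖(s₀ : Octonion) - s‖ := by fun_prop
  filter_upwards [(hc.tendsto s₀).eventually_lt_const (u := 1) (by simp)] with s hs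
  exact mem_pushSliceResolventSet_of_norm_lt hJ hs₀ s.2 hs

theorem pushSliceResolventSet_congr {J K : Octonion} (h : slice J = slice K) :
    pushSliceResolventSet J T = pushSliceResolventSet K T := by
  simp only [pushSliceResolventSet, IsLiftablePowerAssociative, h]

/-- A non-real point determines its slice, and the resolvent condition depends on `J` only through
the slice. A real point lies in every slice, so for it the condition may depend on `J`. -/
theorem mem_pushSliceResolventSet_of_notMem_reals {J s : Octonion} (hJ : J ∈ imagUnits)
    (hsJ : s ∈ slice J) (hs : s ∈ pushResolventSet T) (hr : s ∉ reals) :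
    s ∈ pushSliceResolventSet J T := by
  obtain ⟨K, hK, hsK⟩ := Set.mem_iUnion₂.mp hs
  rwa [← pushSliceResolventSet_congr (slice_eq_of_mem hJ hK hsJ hsK.1 hr)]

theorem pushSliceResolventSet_subset {J : Octonion} (hJ : J ∈ imagUnits) :
    pushSliceResolventSet J T ⊆ pushResolventSet T :=
  Set.subset_biUnion_of_mem (u := fun J => pushSliceResolventSet J T) hJ

theorem isSliceOpen_pushResolventSet_diff_reals [CompleteSpace V] (T : V →L[ℝ] V) :
    IsSliceOpen (pushResolventSet T \ reals) := fun J hJ => by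
  have h : {s : slice J | (s : Octonion) ∈ pushResolventSet T \ reals} =
      {s : slice J | (s : Octonion) ∈ pushSliceResolventSet J T} ∩
        (Subtype.val ⁻¹' realsᶜ) := by
    ext s
    exact ⟨fun hs => ⟨mem_pushSliceResolventSet_of_notMem_reals hJ s.2 hs.1 hs.2, hs.2⟩,
      fun hs => ⟨pushSliceResolventSet_subset hJ hs.1, hs.2⟩⟩
  rw [IsOpenInSlice, h]
  exact (isOpenInSlice_pushSliceResolventSet T hJ).inter
    (isClosed_reals.isOpen_compl.preimage continuous_subtype_val)

theorem isSliceOpen_pushResolventSet [CompleteSpace V]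
    (h : ∀ J ∈ imagUnits, pushResolventSet T ∩ reals ⊆ pushSliceResolventSet J T) :
    IsSliceOpen (pushResolventSet T) := fun J hJ => by
  have heq : {s : slice J | (s : Octonion) ∈ pushResolventSet T} =
      {s : slice J | (s : Octonion) ∈ pushSliceResolventSet J T} := by
    ext s
    refine ⟨fun hs => ?_, fun hs => pushSliceResolventSet_subset hJ hs⟩
    by_cases hr : (s : Octonion) ∈ reals
    · exact h J hJ ⟨hs, hr⟩
    · exact mem_pushSliceResolventSet_of_notMem_reals hJ s.2 hs hr
  rw [IsOpenInSlice, heq]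
  exact isOpenInSlice_pushSliceResolventSet T hJ

/-! ### Holomorphy of the left regular inverse. -/

/-- The real derivative of the resolvent along the slice. -/
theorem hasFDerivAt_inverse_rightMul_ofComplex [CompleteSpace V] {J : Octonion} {z : ℂ}
    (hu : IsUnit (rightMul (ofComplex J z) - T)) :
    ∃ L : ℂ →L[ℝ] V →L[ℝ] V,
      HasFDerivAt (fun w => Ring.inverse (rightMul (ofComplex J w) - T)) L z ∧
      ∀ h, L h = -(Ring.inverse (rightMul (ofComplex J z) - T) * rightMul (ofComplex J h) *
        Ring.inverse (rightMul (ofComplex J z) - T)) := by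
  let D : ℂ →L[ℝ] V →L[ℝ] V := Complex.reCLM.smulRight (1 : V →L[ℝ] V) +
    Complex.imCLM.smulRight (rightMul J)
  have hD : ∀ w, rightMul (V := V) (ofComplex J w) = D w := fun w => by
    rw [rightMul_ofComplex]; rfl
  obtain ⟨u, hu⟩ := hu
  have h1 : HasFDerivAt (fun w => D w - T) D z := D.hasFDerivAt.sub_const T
  have h2 := hasFDerivAt_ringInverse (𝕜 := ℝ) u
  simp only [hD] at hu ⊢
  rw [hu] at h2
  refine ⟨_, HasFDerivAt.comp (f := fun w => D w - T) z h2 h1, fun h => ?_⟩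
  rw [← hu, Ring.inverse_unit]
  simp

/-- The complex function representing the resolvent in a slice is complex differentiable. -/
theorem differentiableAt_resolvent_component [CompleteSpace V] {J : Octonion}
    (hJ : J ∈ imagUnits) {φ : V →L[ℝ] Octonion} (hφ : IsOctonionLinear φ) (v : V) {z : ℂ}
    (hz : ofComplex J z ∈ pushSliceResolventSet J T) :
    DifferentiableAt ℂ (fun w : ℂ =>
      (⟨φ ((Ring.inverse (rightMul (ofComplex J w) - T) : V →L[ℝ] V) v) 0,
        -(φ ((Ring.inverse (rightMul (ofComplex J w) - T) : V →L[ℝ] V) (rightMul J v)) 0)⟩ : ℂ)) z := by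
  obtain ⟨-, hu, hA⟩ := hz
  obtain ⟨L, hL, hLapp⟩ := hasFDerivAt_inverse_rightMul_ofComplex hu
  set A : V →L[ℝ] V := Ring.inverse (rightMul (ofComplex J z) - T) with hAdef
  rw [isLiftablePowerAssociative_iff] at hA
  -- The coordinate `(φ x) 0` depends only on `Re x`, so identities modulo the kernel of `Re`
  -- suffice.
  have hcomp : ∀ {x y : V}, rePart x = rePart y → φ x 0 = φ y 0 := fun {x y} h => by
    have h := congrArg φ h
    have hr := map_rePart (φ := φ.toLinearMap) hφ
    simp only [ContinuousLinearMap.coe_coe] at hr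
    rw [hr, hr] at h
    simpa [one_def, e] using congrArg (fun o : Octonion => o 0) h
  let ψ : V →L[ℝ] ℝ := (EuclideanSpace.proj (0 : Fin 8) : Octonion →L[ℝ] ℝ).comp φ
  let E (w : V) : (V →L[ℝ] V) →L[ℝ] ℝ := ψ.comp (ContinuousLinearMap.apply ℝ V w)
  have hd : ∀ w : V, HasFDerivAt
      (fun ζ => φ ((Ring.inverse (rightMul (ofComplex J ζ) - T) : V →L[ℝ] V) w) 0) ((E w).comp L) z :=
    fun w => (E w).hasFDerivAt.comp z hL
  have hL1 : ∀ w, (E w).comp L 1 = -(φ (A (A w)) 0) := fun w => by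
    have : rightMul (V := V) (ofComplex J 1) = 1 := by simp [rightMul_ofComplex]
    change ψ (L 1 w) = _
    rw [hLapp, this]
    simp [ψ]
  have hLI : ∀ w, (E w).comp L Complex.I = -(φ (A (A (rightMul J w))) 0) := fun w => by
    have h1 : rightMul (V := V) (ofComplex J Complex.I) = rightMul J := by
      simp [rightMul_ofComplex]
    -- Under `Re`, both `A R_J A w` and `A² R_J w` equal `R_J A² w`, by liftability with exponents
    -- `1` and `2`.
    have h2 : φ (A (rightMul J (A w))) 0 = φ (A (A (rightMul J w))) 0 := by
      refine hcomp ?_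
      have e1 := hA 1 (A w)
      have e2 := hA 2 w
      rw [pow_one] at e1
      rw [pow_two] at e2
      exact e1.trans e2.symm
    change ψ (L Complex.I w) = _
    rw [hLapp, h1, ← h2]
    simp [ψ]
  have hF : HasFDerivAt (fun w : ℂ =>
      (⟨φ ((Ring.inverse (rightMul (ofComplex J w) - T) : V →L[ℝ] V) v) 0,
        -(φ ((Ring.inverse (rightMul (ofComplex J w) - T) : V →L[ℝ] V) (rightMul J v)) 0)⟩ : ℂ))
      (Complex.equivRealProdCLM.symm.toContinuousLinearMap.comp
        (((E v).comp L).prod (-((E (rightMul J v)).comp L)))) z :=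
    Complex.equivRealProdCLM.symm.toContinuousLinearMap.hasFDerivAt.comp z
      ((hd v).prodMk (hd (rightMul J v)).neg)
  -- What remains is the Cauchy–Riemann condition, that the real derivative at `I` is `I` times the
  -- derivative at `1`. The imaginary part uses `R_J² = -1`.
  rw [differentiableAt_complex_iff_differentiableAt_real]
  refine ⟨hF.differentiableAt, ?_⟩
  rw [hF.fderiv]
  have a1 := hL1 v
  have a2 := hL1 (rightMul J v)
  have a3 := hLI v
  have a4 := hLI (rightMul J v)
  rw [rightMul_imagUnit_sq hJ] at a4
  apply Complex.ext
  · change (E v).comp L Complex.I = (Complex.I * ⟨(E v).comp L 1, -((E (rightMul J v)).comp L 1)⟩ : ℂ).re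
    rw [a2, a3]; simp
  · change -((E (rightMul J v)).comp L Complex.I) =
      (Complex.I * ⟨(E v).comp L 1, -((E (rightMul J v)).comp L 1)⟩ : ℂ).im
    rw [a1, a4]; simp

theorem isHolomorphicOnSlice_leftRegularInverse [CompleteSpace V] (T : V →L[ℝ] V) (v : V)
    {J : Octonion} (hJ : J ∈ imagUnits) {φ : V →L[ℝ] Octonion} (hφ : IsOctonionLinear φ) :
    IsHolomorphicOnSlice J
      (fun s => φ (sliceProj J (leftRegularInverse (rightMul s - T) v)))
      (pushSliceResolventSet J T) := by
  -- This identity is purely algebraic and holds for every `s`, including those where `Ring.inverse`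
  -- takes its default value `0`.
  have hg : ∀ s, φ (sliceProj J (leftRegularInverse (rightMul s - T) v)) =
      ofComplex J ⟨φ ((Ring.inverse (rightMul s - T) : V →L[ℝ] V) v) 0,
        -(φ ((Ring.inverse (rightMul s - T) : V →L[ℝ] V) (rightMul J v)) 0)⟩ := fun s =>
    map_sliceProj_liftR (φ := φ.toLinearMap) hφ hJ _ v
  refine ⟨fun s _ => mem_slice_iff.mpr ⟨_, (hg s).symm⟩, _, fun z hz =>
    (differentiableAt_resolvent_component hJ hφ v hz).differentiableWithinAt, fun z _ => hg _⟩

end OctonionBimodule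

theorem mainTheorem7 {V : Type*} [NormedAddCommGroup V] [NormedSpace ℝ V] [CompleteSpace V]
    [NormedOctonionBimodule V] (T : V →L[ℝ] V) (hT : OctonionBimodule.IsRightParaLinear T) :
    (∀ J ∈ Octonion.imagUnits,
      Octonion.IsOpenInSlice J (OctonionBimodule.pushSliceResolventSet J T)) ∧
    Octonion.IsSliceOpen (OctonionBimodule.pushResolventSet T \ Octonion.reals) ∧
    ((∀ J ∈ Octonion.imagUnits, OctonionBimodule.pushResolventSet T ∩ Octonion.reals ⊆
        OctonionBimodule.pushSliceResolventSet J T) →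
      Octonion.IsSliceOpen (OctonionBimodule.pushResolventSet T)) ∧
    ∀ (v : V), ∀ J ∈ Octonion.imagUnits, ∀ φ : V →L[ℝ] Octonion,
      OctonionBimodule.IsOctonionLinear φ →
        Octonion.IsHolomorphicOnSlice J
          (fun s => φ (OctonionBimodule.sliceProj J
            (OctonionBimodule.leftRegularInverse (OctonionBimodule.rightMul s - T) v)))
          (OctonionBimodule.pushSliceResolventSet J T) :=
  ⟨fun J hJ => OctonionBimodule.isOpenInSlice_pushSliceResolventSet T hJ,
    OctonionBimodule.isSliceOpen_pushResolventSet_diff_reals T,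
    OctonionBimodule.isSliceOpen_pushResolventSet,
    fun v _ hJ _ => OctonionBimodule.isHolomorphicOnSlice_leftRegularInverse T v hJ⟩
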